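/- **Conventions.** Graphs are undirected and locally finite, with loops and multiple edges allowed, and are described by directed edges: a directed edge $d$ runs from $s(d)$ to $t(d)$ and has a reversal $\bar d$ running from $t(d)$ to $s(d)$, with $\bar{\bar d}=d$; an undirected edge is an orbit $\{d,\bar d\}$. A (whole) loop consists of two directed edges, a half-loop ($\bar d=d$) of one; half-loops are allowed. Colorings and coefficients are functions of undirected edges. Given nonzero real coefficients $a$ on the edges of a graph with vertex set $\mathcal V$, its weighted adjacency matrix, or Jacobi operator (with zero vertex coefficients), is $(Af)(x)=\sum_{d:\,s(d)=x}a_d\,f(t(d))$; so a whole loop $l$ at $x$ contributes $2a_lf(x)$ and a half-loop $l$ contributes $a_lf(x)$. For a vertex $x$, the state induced by $x$ is $X\mapsto\langle\delta_x,X\delta_x\rangle$. **The product.** Let $\mathcal G_1,\dots,\mathcal G_n$ be finite graphs with vertex sets $\mathcal V_i$ and roots $e_i\in\mathcal V_i$, let $\mathcal C_1,\dots,\mathcal C_n$ be disjoint finite sets, let $c_i$ be an edge coloring of $\mathcal G_i$ with colors in $\mathcal C_i$, and let $\mathcal G$ be a graph with vertex set $[k]$ and root $r\in[k]$, with an edge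 coloring $c$ with colors in $\bigcup_i\mathcal C_i$ (the relator graph). Let $a^{(i)}$ and $a^{(0)}$ be nonzero real edge coefficients on $\mathcal G_i$ and $\mathcal G$. Let $\mathcal W$ be the set of words $v_m\cdots v_1$ ($m\ge 0$) with $v_p\in\mathcal V_{i_p}\setminus\{e_{i_p}\}$ and $i_p\ne i_{p+1}$; the empty word is denoted by $e$, and one sets $e_iu=u$. The amalgamated free product $*_{(\mathcal G,c)}\{(\mathcal G_i,c_i)\}_{i=1}^n$ is the graph with vertex set $[k]\times\mathcal W$ and root $(r,e)$, whose directed edges are the triples consisting of a directed edge $d=(v,v')$ of some $\mathcal G_j$, a directed edge $d_0=(i,i')$ of $\mathcal G$ with $c(d_0)=c_j(d)$, and a word $u\in\mathcal W$ whose leftmost letter is not in $\mathcal V_j$. Such a triple runs from $(i,vu)$ to $(i',v'u)$, its reversal is $(\bar d,\bar d_0,u)$, and its coefficient is $a^{(0)}_{d_0}a^{(j)}_{d}$. The core of the product is the connected component of $(r,e)$. **Theorem.** For $i\in[n]$ and $\alpha\in\mathcal C_i$ let $A_\alpha\in M_{\mathcal V_i}(\mathbb C)$ and $X_\alpha\in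 M_k(\mathbb C)$ be the weighted adjacency matrices of the subgraphs $\mathcal G_i[\alpha]$ and $\mathcal G[\alpha]$ formed by all the vertices and the edges of color $\alpha$, with the coefficients above. Then there are a unital $\mathbb C$-algebra $\mathcal A$, a unital linear functional $\tau:\mathcal A\to\mathbb C$, and elements $T_1,\dots,T_n\in\mathcal A$ such that: 1. The Jacobi operator $J$ of the core, with the coefficients above, is a bounded operator on $\ell^2$ of the core, and $\tau\big((T_1+\cdots+T_n)^p\big)=\langle\delta_{(r,e)},J^p\delta_{(r,e)}\rangle$ for all $p\ge 0$. 2. There are a unital subalgebra $\mathcal B\subset\mathcal A$, an isomorphism $\theta:M_k(\mathbb C)\to\mathcal B$ and a linear map $E:\mathcal A\to\mathcal B$ with $E|_{\mathcal B}=\mathrm{Id}$, $E(b_1xb_2)=b_1E(x)b_2$ for $b_1,b_2\in\mathcal B$, and $\tau\circ E=\tau$, such that $T_1,\dots,T_n$ are free with amalgamation over $\mathcal B$ with respect to $E$. That is, if $\mathcal A_i$ denotes the algebra generated by $\mathcal B$ and $T_i$, then $E(x_1\cdots x_m)=0$ whenever $m\ge1$, $x_p\in\mathcal A_{j_p}$,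 $E(x_p)=0$ for all $p$, and $j_p\ne j_{p+1}$ for all $p<m$. 3. For each $i\in[n]$, with the conditional expectation $E_i=\mathrm{Id}\otimes\langle\delta_{e_i},\,\cdot\,\delta_{e_i}\rangle:M_k(\mathbb C)\otimes M_{\mathcal V_i}(\mathbb C)\to M_k(\mathbb C)$, the element $Y_i=\sum_{\alpha\in\mathcal C_i}X_\alpha\otimes A_\alpha$ has the same $M_k(\mathbb C)$-valued distribution as $T_i$: for all $m\ge0$ and $b_0,\dots,b_m\in M_k(\mathbb C)$, $$E\big(\theta(b_0)T_i\theta(b_1)T_i\cdots T_i\theta(b_m)\big)=\theta\big(E_i\big((b_0\otimes1)Y_i(b_1\otimes1)Y_i\cdots Y_i(b_m\otimes1)\big)\big).$$ -/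

import Mathlib

open scoped TensorProduct

universe u v v' w

noncomputable section

namespace FreeGraphProduct

/-! ### Graphs, colorings, coefficients -/

/-- A locally finite undirected graph with vertex set `V`, loops and multiple edges allowed, given by
its directed edges (darts) with the edge reversal `rev`. An undirected edge is an orbit
`{d, rev d}`. An edge between distinct vertices and a (whole) loop are both two darts exchanged by
`rev`; a dart with `rev d = d` is a half-loop. -/
structure Multigraph (V : Type u) where
  /-- directed edges -/
  Dart : Type v
  /-- initial vertex -/
  src : Dart → V
  /-- terminal vertex -/
  tgt : Dart → V
  /-- edge reversal -/
  rev : Dart → Dart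
  rev_rev : ∀ d, rev (rev d) = d
  src_rev : ∀ d, src (rev d) = tgt d
  locallyFinite : ∀ x : V, Finite {d : Dart // src d = x}

namespace Multigraph

variable {V : Type u}

theorem tgt_rev (G : Multigraph.{u, v} V) (d : G.Dart) : G.tgt (G.rev d) = G.src d := by
  rw [← G.src_rev, G.rev_rev]

/-- A graph with finitely many vertices has finitely many directed edges. -/
theorem finite_dart (G : Multigraph.{u, v} V) [Finite V] : Finite G.Dart := by
  have := G.locallyFinite
  exact Finite.of_injective (fun d : G.Dart => (⟨G.src d, d, rfl⟩ : Σ x : V, {d // G.src d = x}))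
    (fun a b h => by
      have h1 : G.src a = G.src b := congrArg Sigma.fst h
      rw [Sigma.mk.injEq] at h
      obtain ⟨_, h⟩ := h
      exact (Subtype.heq_iff_coe_eq (by intro x; rw [h1])).1 h)

/-- An edge coloring: a coloring of the darts that is constant on undirected edges. -/
structure Coloring (G : Multigraph.{u, v} V) (C : Type w) where
  /-- the color of a directed edge -/
  col : G.Dart → C
  col_rev : ∀ d, col (G.rev d) = col d

/-- Nonzero real coefficients `a_e` on the undirected edges. -/
structure Coeff (G : Multigraph.{u, v} V) where
  /-- the coefficient of the edge underlying a directed edge -/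
  a : G.Dart → ℝ
  a_rev : ∀ d, a (G.rev d) = a d
  a_ne_zero : ∀ d, a d ≠ 0

/-- `G[α]`: the graph with the same vertices that keeps only the edges of color `α`. -/
def ofColor (G : Multigraph.{u, v} V) {C : Type w} (c : G.Coloring C) (α : C) :
    Multigraph.{u, v} V where
  Dart := {d : G.Dart // c.col d = α}
  src d := G.src d.1
  tgt d := G.tgt d.1
  rev d := ⟨G.rev d.1, (c.col_rev d.1).trans d.2⟩
  rev_rev d := Subtype.ext (G.rev_rev d.1)
  src_rev d := G.src_rev d.1
  locallyFinite x := by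
    have := G.locallyFinite x
    exact Finite.of_injective
      (fun d : {d : {d : G.Dart // c.col d = α} // G.src d.1 = x} =>
        (⟨d.1.1, d.2⟩ : {d : G.Dart // G.src d = x}))
      (fun a b h => Subtype.ext (Subtype.ext (Subtype.mk.inj h)))

/-- The coefficients of `G`, restricted to `G[α]`. -/
def Coeff.ofColor {G : Multigraph.{u, v} V} (a : G.Coeff) {C : Type w} (c : G.Coloring C) (α : C) :
    (G.ofColor c α).Coeff where
  a d := a.a d.1
  a_rev d := a.a_rev d.1
  a_ne_zero d := a.a_ne_zero d.1

/-- The weighted adjacency operator on functions,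
`(A f)(x) = ∑ a_d f(y)` over all directed edges `d = (x, y)` leaving `x` (a finite sum).
So an edge `{x, y}` with `y ≠ x` contributes `a_e f(y)`, a whole loop at `x` contributes
`2 a_l f(x)`, and a half-loop at `x` contributes `a_l f(x)`. -/
def adjAction (G : Multigraph.{u, v} V) (a : G.Coeff) (f : V → ℂ) (x : V) : ℂ :=
  ∑ᶠ d : {d : G.Dart // G.src d = x}, (a.a d.1 : ℂ) * f (G.tgt d.1)

/-- The weighted adjacency matrix of a graph. -/
def adjMatrix (G : Multigraph.{u, v} V) (a : G.Coeff) : Matrix V V ℂ :=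
  Matrix.of fun x y => ∑ᶠ d : {d : G.Dart // G.src d = x ∧ G.tgt d = y}, (a.a d.1 : ℂ)

open Classical in
/-- The unit vector `δ_x` of `ℓ²(V)`. -/
def delta (x : V) : lp (fun _ : V => ℂ) 2 := lp.single 2 x (1 : ℂ)

/-- The state `X ↦ ⟨δ_x, X δ_x⟩` on bounded operators on `ℓ²(V)`. -/
def rootState (x : V) (X : lp (fun _ : V => ℂ) 2 →L[ℂ] lp (fun _ : V => ℂ) 2) : ℂ :=
  inner ℂ (delta x) (X (delta x))

/-- The bounded operator `J` on `ℓ²(V)` is the Jacobi operator of `G` with edge coefficients `a`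
and zero vertex coefficients. -/
def IsJacobiOperator (G : Multigraph.{u, v} V) (a : G.Coeff)
    (J : lp (fun _ : V => ℂ) 2 →L[ℂ] lp (fun _ : V => ℂ) 2) : Prop :=
  ∀ (f : lp (fun _ : V => ℂ) 2) (x : V), (J f : V → ℂ) x = G.adjAction a f x

/-- There is a path from `x` to `y`. -/
def Reachable (G : Multigraph.{u, v} V) : V → V → Prop :=
  Relation.ReflTransGen fun x y => ∃ d : G.Dart, G.src d = x ∧ G.tgt d = y

/-- The connected component of `r`. -/
def component (G : Multigraph.{u, v} V) (r : V) : Multigraph.{u, v} {x : V // G.Reachable r x} where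
  Dart := {d : G.Dart // G.Reachable r (G.src d)}
  src d := ⟨G.src d.1, d.2⟩
  tgt d := ⟨G.tgt d.1, d.2.tail ⟨d.1, rfl, rfl⟩⟩
  rev d := ⟨G.rev d.1, by rw [G.src_rev]; exact d.2.tail ⟨d.1, rfl, rfl⟩⟩
  rev_rev d := Subtype.ext (G.rev_rev d.1)
  src_rev d := Subtype.ext (G.src_rev d.1)
  locallyFinite x := by
    have := G.locallyFinite x.1
    exact Finite.of_injective
      (fun d : {d : {d : G.Dart // G.Reachable r (G.src d)} //
          (⟨G.src d.1, d.2⟩ : {x : V // G.Reachable r x}) = x} =>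
        (⟨d.1.1, congrArg Subtype.val d.2⟩ : {d : G.Dart // G.src d = x.1}))
      (fun a b h => Subtype.ext (Subtype.ext (Subtype.mk.inj h)))

/-- The coefficients of `G`, restricted to the connected component of `r`. -/
def Coeff.component {G : Multigraph.{u, v} V} (a : G.Coeff) (r : V) : (G.component r).Coeff where
  a d := a.a d.1
  a_rev d := a.a_rev d.1
  a_ne_zero d := a.a_ne_zero d.1

/-- The root of the connected component of `r`. -/
def componentRoot (G : Multigraph.{u, v} V) (r : V) : {x : V // G.Reachable r x} :=
  ⟨r, Relation.ReflTransGen.refl⟩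

end Multigraph

/-! ### Words: the vertices of the free product of rooted graphs -/

section Words

variable {n : ℕ} {V : Fin n → Type u}

/-- Words `v_m ⋯ v_1` (the leftmost letter is the head of the list) in letters `v_k` that are
non-root vertices of the graphs, with consecutive letters from different graphs. -/
@[ext]
structure Word (e : ∀ j, V j) where
  /-- the letters, from left to right -/
  letters : List (Σ j, V j)
  ne_root : ∀ x ∈ letters, x.2 ≠ e x.1
  alternating : letters.IsChain fun x y => x.1 ≠ y.1

/-- The empty word. -/
def Word.nil (e : ∀ j, V j) : Word e := ⟨[], by simp, by simp⟩

/-- The word does not begin (on the left) with a letter from the `j`-th graph. -/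
def Word.Avoids {e : ∀ j, V j} (u : Word e) (j : Fin n) : Prop :=
  ∀ x ∈ u.letters.head?, j ≠ x.1

open Classical in
/-- The word `v u`, where the root `e_j` plays the role of the empty word. -/
def Word.cons {e : ∀ j, V j} (j : Fin n) (v : V j) (u : Word e) (h : u.Avoids j) : Word e :=
  if hv : v = e j then u
  else
    { letters := ⟨j, v⟩ :: u.letters
      ne_root := by
        intro x hx
        rcases List.mem_cons.1 hx with rfl | hx
        · exact hv
        · exact u.ne_root x hx
      alternating := List.isChain_cons.2 ⟨h, u.alternating⟩ }

theorem Word.cons_injective {e : ∀ j, V j} (j : Fin n) (v : V j) {u u' : Word e}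
    {h : u.Avoids j} {h' : u'.Avoids j} (H : Word.cons j v u h = Word.cons j v u' h') : u = u' := by
  by_cases hv : v = e j
  · simpa [Word.cons, hv] using H
  · rw [Word.cons, Word.cons, dif_neg hv, dif_neg hv] at H
    exact Word.ext (List.cons.inj (congrArg Word.letters H)).2

end Words

/-! ### The amalgamated free product of graphs -/

section Product

variable {n k : ℕ} {V : Fin n → Type u} {C : Fin n → Type w}

/-- Directed edges of the amalgamated free product: a directed edge `d = (v, v')` of some `𝒢_j`, a
directed edge `d₀ = (i, i')` of the relator graph of the same color, and a word `u` not beginning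
with a letter from `𝒢_j`. It runs from `(i, v u)` to `(i', v' u)`. The color set is the disjoint
union `Σ j, C j` of the color sets of the `𝒢_j`. -/
@[ext]
structure ProdDart (e : ∀ j, V j) (G : ∀ j, Multigraph.{u, v} (V j)) (c : ∀ j, (G j).Coloring (C j))
    (R : Multigraph.{0, v'} (Fin k)) (c₀ : R.Coloring (Σ j, C j)) where
  /-- which of the graphs `𝒢_j` the edge comes from -/
  j : Fin n
  /-- the directed edge of `𝒢_j` -/
  d : (G j).Dart
  /-- the directed edge of the relator graph -/
  d₀ : R.Dart
  /-- the common right part of the two words -/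
  u : Word e
  avoids : u.Avoids j
  color_eq : c₀.col d₀ = ⟨j, (c j).col d⟩

variable [∀ j, Finite (V j)]
  (e : ∀ j, V j) (G : ∀ j, Multigraph.{u, v} (V j)) (c : ∀ j, (G j).Coloring (C j))
  (R : Multigraph.{0, v'} (Fin k)) (c₀ : R.Coloring (Σ j, C j))

/-- The free product of the colored rooted graphs `(𝒢_j, e_j, c_j)` with amalgamation over the
relator graph `(R, c₀)`, on the vertex set `[k] × {words}`. -/
def amalgProd : Multigraph.{u, max u v v'} (Fin k × Word e) where
  Dart := ProdDart e G c R c₀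
  src D := (R.src D.d₀, Word.cons D.j ((G D.j).src D.d) D.u D.avoids)
  tgt D := (R.tgt D.d₀, Word.cons D.j ((G D.j).tgt D.d) D.u D.avoids)
  rev D :=
    { j := D.j
      d := (G D.j).rev D.d
      d₀ := R.rev D.d₀
      u := D.u
      avoids := D.avoids
      color_eq := by rw [c₀.col_rev, (c D.j).col_rev]; exact D.color_eq }
  rev_rev D := by
    ext <;> simp [Multigraph.rev_rev]
  src_rev D := by simp [Multigraph.src_rev]
  locallyFinite x := by
    have := R.finite_dart
    have := fun j => (G j).finite_dart
    refine Finite.of_injective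
      (fun D : {D : ProdDart e G c R c₀ // (R.src D.d₀,
          Word.cons D.j ((G D.j).src D.d) D.u D.avoids) = x} =>
        ((⟨D.1.j, D.1.d⟩, D.1.d₀) : (Σ j, (G j).Dart) × R.Dart)) ?_
    rintro ⟨⟨j, d, d₀, u, h, hc⟩, hx⟩ ⟨⟨j', d', d₀', u', h', hc'⟩, hx'⟩ H
    simp only [Prod.mk.injEq, Sigma.mk.injEq] at H
    obtain ⟨⟨rfl, H⟩, rfl⟩ := H
    obtain rfl := eq_of_heq H
    have hu : u = u' :=
      Word.cons_injective j _ (h := h) (h' := h') (congrArg Prod.snd (hx.trans hx'.symm))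
    subst hu
    rfl

variable {G R}

/-- The lift of the coefficients to the product:
`a_{(i, v u), (i', v' u)} = a⁰_{i, i'} a^{(j)}_{v, v'}`. -/
def liftCoeff (a : ∀ j, (G j).Coeff) (a₀ : R.Coeff) : (amalgProd e G c R c₀).Coeff where
  a (D : ProdDart e G c R c₀) := a₀.a D.d₀ * (a D.j).a D.d
  a_rev (D : ProdDart e G c R c₀) := by
    change a₀.a (R.rev D.d₀) * (a D.j).a ((G D.j).rev D.d) = _
    rw [a₀.a_rev, (a D.j).a_rev]
  a_ne_zero (D : ProdDart e G c R c₀) := mul_ne_zero (a₀.a_ne_zero _) ((a D.j).a_ne_zero _)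

variable (G R)

/-- The core of the product: the connected component of the root `(r, e)`. -/
def core (r : Fin k) :
    Multigraph.{u, max u v v'} {x // (amalgProd e G c R c₀).Reachable (r, Word.nil e) x} :=
  (amalgProd e G c R c₀).component (r, Word.nil e)

/-- The root of the core. -/
def coreRoot (r : Fin k) : {x // (amalgProd e G c R c₀).Reachable (r, Word.nil e) x} :=
  (amalgProd e G c R c₀).componentRoot (r, Word.nil e)

variable {G R}

/-- The lifted coefficients on the core. -/
def coreCoeff (r : Fin k) (a : ∀ j, (G j).Coeff) (a₀ : R.Coeff) : (core e G c R c₀ r).Coeff :=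
  (liftCoeff e c c₀ a a₀).component (r, Word.nil e)

end Product

/-! ### Operator-valued probability -/

section OperatorValued

variable {A : Type*} [Ring A] [Algebra ℂ A]

/-- `E` is a conditional expectation of `A` onto the unital subalgebra `B`. -/
structure IsCondExp (B : Subalgebra ℂ A) (E : A →ₗ[ℂ] B) : Prop where
  restrict_eq_id : ∀ b : B, E b = b
  bimodule : ∀ (b₁ b₂ : B) (x : A), E (b₁ * x * b₂) = b₁ * E x * b₂

/-- The subalgebras `S i ⊇ B` are free with amalgamation over `B` with respect to `E`. -/
def FreeWithAmalgamation {I : Type*} (B : Subalgebra ℂ A) (E : A →ₗ[ℂ] B)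
    (S : I → Subalgebra ℂ A) : Prop :=
  (∀ i, B ≤ S i) ∧
  ∀ (m : ℕ) (j : Fin (m + 1) → I) (x : Fin (m + 1) → A),
    (∀ p : Fin m, j p.castSucc ≠ j p.succ) → (∀ p, x p ∈ S (j p)) → (∀ p, E (x p) = 0) →
      E (List.ofFn x).prod = 0

/-- The subalgebra generated by `B` and the random variable `t`. -/
def adjoinVar (B : Subalgebra ℂ A) (t : A) : Subalgebra ℂ A :=
  Algebra.adjoin ℂ ((B : Set A) ∪ {t})

/-- The operator-valued moment `E(b₀ t b₁ t b₂ ⋯ t b_m)`, where `bs = [b₁, …, b_m]`; here the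
coefficient algebra `M` acts through `ι : M → A` and `E : A → M`. -/
def opMoment {M : Type*} [Ring M] [Algebra ℂ M] (ι : M →ₐ[ℂ] A) (E : A →ₗ[ℂ] M) (t : A)
    (b₀ : M) (bs : List M) : M :=
  E (ι b₀ * (bs.map fun b => t * ι b).prod)

/-- Two variables in two `M`-valued probability spaces have the same `M`-valued distribution. -/
def SameOpDistribution {M A' : Type*} [Ring M] [Algebra ℂ M] [Ring A'] [Algebra ℂ A']
    (ι : M →ₐ[ℂ] A) (E : A →ₗ[ℂ] M) (t : A) (ι' : M →ₐ[ℂ] A') (E' : A' →ₗ[ℂ] M) (t' : A') : Prop :=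
  ∀ (b₀ : M) (bs : List M), opMoment ι E t b₀ bs = opMoment ι' E' t' b₀ bs

/-- The functional `X ↦ ⟨δ_x, X δ_x⟩ = X_{xx}` on matrices. -/
def vertexState {V : Type*} (x : V) : Matrix V V ℂ →ₗ[ℂ] ℂ := Matrix.entryLinearMap ℂ ℂ x x

/-- The conditional expectation `Id ⊗ φ : M ⊗ A → M` for a linear functional `φ` on `A`. -/
def tensorExp (M : Type*) [Ring M] [Algebra ℂ M] (φ : A →ₗ[ℂ] ℂ) : M ⊗[ℂ] A →ₗ[ℂ] M :=
  (TensorProduct.rid ℂ M).toLinearMap ∘ₗ LinearMap.lTensor M φ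

end OperatorValued

end FreeGraphProduct

end

open scoped TensorProduct
open FreeGraphProduct

noncomputable section

namespace FreeGraphProduct

/-! ### Ampliations of matrices -/

section Ampliation

variable {ι U X : Type*} [Fintype ι] [DecidableEq ι]

/-! The argument takes place in the algebra of all linear endomorphisms of the space of functions on
`[k] × W`; `ℓ²` enters only through `J`. For fixed `j` every word is uniquely `v u` with `v ∈ V_j`
and `u` not beginning in `V_j` (`Word.cons_bijective`). Hence the vertex set is `([k] × V_j) × {u}`,
and `M_k ⊗ M_{V_j}` acts on the first factor (`factorHom`, `tensorHom`). The subalgebra `M_k ⊗ 1`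
acts in the same way for every `j`; this is the amalgamated algebra. The expectation `blockExp`
compresses to the block over the empty word. On the `j`-th factor it is `Id` tensored with the state
of `e_j` (`blockExp_tensorHom`), which gives the operator-valued distributions.

Freeness is the usual free product argument: a centered element of the `j`-th factor sends functions
supported on words avoiding `V_j` to functions supported on words beginning in `V_j`
(`factorHom_apply_eq_zero`). An alternating product of centered elements therefore sends point
masses over the empty word to functions vanishing there.

Take for `T_j` the image of `∑ X_α ⊗ A_α`. Its action at `(b, v u)` is a sum over pairs of equally
colored edges leaving `b` and `v`, which are the edges of the product coming from `𝒢_j`. So `∑ T_j`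
is the adjacency operator of the product (`sum_tensorHom_colorSum_apply`), and at a core vertex it
only sees the core. `J` is bounded because an edge of the product is determined by its source and
one of finitely many pairs `(d, d₀)`. -/

/-- A matrix acting on the first factor of a set of indices `X ≃ ι × U`. -/
def ampliation (s : ι × U ≃ X) : Matrix ι ι ℂ →ₐ[ℂ] Module.End ℂ (X → ℂ) :=
  AlgHom.ofLinearMap
    { toFun M :=
        { toFun f x := ∑ i, M (s.symm x).1 i * f (s (i, (s.symm x).2))
          map_add' f g := by
            ext x; simp [mul_add, Finset.sum_add_distrib]
          map_smul' z f := by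
            ext x; simp [Finset.mul_sum, mul_left_comm] }
      map_add' M N := by
        ext f x; simp [add_mul, Finset.sum_add_distrib]
      map_smul' z M := by
        ext f x; simp [Finset.mul_sum, mul_assoc] }
    (by
      refine LinearMap.ext fun f => funext fun x => ?_
      simp [Matrix.one_apply])
    (by
      intro M N
      refine LinearMap.ext fun f => funext fun x => ?_
      simp only [Matrix.mul_apply, LinearMap.coe_mk, AddHom.coe_mk, Module.End.mul_apply,
        Equiv.symm_apply_apply, Finset.sum_mul, Finset.mul_sum, mul_assoc]
      exact Finset.sum_comm)

theorem ampliation_apply (s : ι × U ≃ X) (M : Matrix ι ι ℂ) (f : X → ℂ) (i : ι) (u : U) :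
    ampliation s M f (s (i, u)) = ∑ i', M i i' * f (s (i', u)) := by
  simp [ampliation]

end Ampliation

/-! ### Words starting in a given graph -/

namespace Word

variable {n : ℕ} {V : Fin n → Type u} {e : ∀ j, V j}

theorem avoids_nil (j : Fin n) : (Word.nil e).Avoids j := by
  simp [Avoids, Word.nil]

theorem cons_root {j : Fin n} {u : Word e} (h : u.Avoids j) : Word.cons j (e j) u h = u := by
  simp [Word.cons]

theorem not_avoids_cons {j : Fin n} {v : V j} {u : Word e} (h : u.Avoids j) (hv : v ≠ e j) :
    ¬ (Word.cons j v u h).Avoids j := by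
  simp [Word.cons, hv, Avoids]

/-- A word has only one leftmost letter. In the freeness induction this lets the output of one
factor serve as input for the next, different one. -/
theorem avoids_of_not_avoids {i j : Fin n} (hij : i ≠ j) {u : Word e} (h : ¬ u.Avoids j) :
    u.Avoids i := by
  unfold Avoids at h ⊢
  push Not at h
  obtain ⟨x, hx, rfl⟩ := h
  intro y hy
  rw [Option.mem_unique hy hx]
  exact hij

/-- Whether the result begins in the `j`-th graph tells whether `v` is the root or an actual letter;
after that `v` and `u` can be read off. Surjectivity takes `v = e j` for words avoiding `j`, and
otherwise splits off the first letter. -/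
theorem cons_bijective (j : Fin n) :
    Function.Bijective fun p : V j × {u : Word e // u.Avoids j} =>
      Word.cons j p.1 p.2.1 p.2.2 := by
  constructor
  · rintro ⟨v, u, h⟩ ⟨v', u', h'⟩ H
    simp only at H
    have hv : v = v' := by
      by_cases hv : v = e j <;> by_cases hv' : v' = e j
      · rw [hv, hv']
      · subst hv
        rw [cons_root] at H
        exact absurd (H ▸ h) (not_avoids_cons h' hv')
      · subst hv'
        rw [cons_root] at H
        exact absurd (H.symm ▸ h') (not_avoids_cons h hv)
      · rw [Word.cons, Word.cons, dif_neg hv, dif_neg hv'] at H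
        simpa using (List.cons.inj (congrArg Word.letters H)).1
    subst hv
    obtain rfl := Word.cons_injective j v H
    rfl
  · intro w
    by_cases h : w.Avoids j
    · exact ⟨(e j, ⟨w, h⟩), cons_root h⟩
    · obtain ⟨l, hl, hc⟩ := w
      cases l with
      | nil => simp [Avoids] at h
      | cons x l =>
        have hx : j = x.1 := by simpa [Avoids] using h
        obtain ⟨i, v⟩ := x
        subst hx
        have hc' := List.isChain_cons.1 hc
        refine ⟨(v, ⟨⟨l, fun x hx => hl x (List.mem_cons_of_mem _ hx), hc'.2⟩, hc'.1⟩), ?_⟩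
        simp only [Word.cons]
        rw [dif_neg (hl ⟨j, v⟩ List.mem_cons_self)]

/-- The decomposition of words as `v u` with `v` in the `j`-th graph and `u` not beginning with a
letter from it. -/
def consEquiv (j : Fin n) : V j × {u : Word e // u.Avoids j} ≃ Word e :=
  Equiv.ofBijective _ (cons_bijective j)

/-- The decomposition of the vertices of the amalgamated free product. -/
def vertexEquiv (k : ℕ) (j : Fin n) :
    (Fin k × V j) × {u : Word e // u.Avoids j} ≃ Fin k × Word e :=
  (Equiv.prodAssoc _ _ _).trans (Equiv.prodCongr (Equiv.refl _) (consEquiv j))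

end Word

/-! ### The conditional expectation onto `M_k(ℂ)` -/

section BlockExp

variable {k : ℕ} {W : Type*}

/-- The action of `M_k(ℂ)` on functions on `[k] × W`. -/
def blockHom (k : ℕ) (W : Type*) :
    Matrix (Fin k) (Fin k) ℂ →ₐ[ℂ] Module.End ℂ (Fin k × W → ℂ) :=
  ampliation (Equiv.refl _)

theorem blockHom_apply (b : Matrix (Fin k) (Fin k) ℂ) (f : Fin k × W → ℂ) (x : Fin k × W) :
    blockHom k W b f x = ∑ i, b x.1 i * f (i, x.2) :=
  ampliation_apply (Equiv.refl _) b f x.1 x.2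

open Classical in
/-- The compression of an operator to `[k] × {w}`. -/
def blockExp (k : ℕ) (w : W) :
    Module.End ℂ (Fin k × W → ℂ) →ₗ[ℂ] Matrix (Fin k) (Fin k) ℂ where
  toFun X := Matrix.of fun a b => X (Pi.single (b, w) 1) (a, w)
  map_add' X Y := by ext; simp
  map_smul' z X := by ext; simp

open Classical in
theorem blockExp_apply (w : W) (X : Module.End ℂ (Fin k × W → ℂ)) (a b : Fin k) :
    blockExp k w X a b = X (Pi.single (b, w) 1) (a, w) := rfl

theorem blockExp_mul_blockHom (w : W) (X : Module.End ℂ (Fin k × W → ℂ))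
    (b : Matrix (Fin k) (Fin k) ℂ) :
    blockExp k w (X * blockHom k W b) = blockExp k w X * b := by
  classical
  ext i j
  have : blockHom k W b (Pi.single (j, w) 1) = ∑ l, b l j • Pi.single (l, w) 1 := by
    ext x
    obtain ⟨x, y⟩ := x
    rw [blockHom_apply]
    by_cases hy : y = w <;> simp [Pi.single_apply, hy]
  simp [blockExp_apply, Matrix.mul_apply, this, mul_comm]

theorem blockExp_blockHom_mul (w : W) (X : Module.End ℂ (Fin k × W → ℂ))
    (b : Matrix (Fin k) (Fin k) ℂ) :
    blockExp k w (blockHom k W b * X) = b * blockExp k w X := by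
  ext i j
  simp [blockExp_apply, Matrix.mul_apply, blockHom_apply]

theorem blockExp_one (w : W) : blockExp k w (1 : Module.End ℂ (Fin k × W → ℂ)) = 1 := by
  classical
  ext i j
  simp [blockExp_apply, Matrix.one_apply, Pi.single_apply]

theorem blockExp_blockHom (w : W) (b : Matrix (Fin k) (Fin k) ℂ) :
    blockExp k w (blockHom k W b) = b := by
  have := blockExp_mul_blockHom w 1 b
  rwa [one_mul, blockExp_one, one_mul] at this

theorem blockHom_injective (w : W) : Function.Injective (blockHom k W) :=
  Function.LeftInverse.injective (blockExp_blockHom w)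

end BlockExp

/-! ### Freeness -/

section Free

variable {n k : ℕ} {V : Fin n → Type u} [∀ j, Fintype (V j)] [∀ j, DecidableEq (V j)]
  {e : ∀ j, V j}

/-- The `j`-th factor `M_k(ℂ) ⊗ M_{V_j}(ℂ)` acting on the vertices of the free product. -/
def factorHom (e : ∀ j, V j) (k : ℕ) (j : Fin n) :
    Matrix (Fin k × V j) (Fin k × V j) ℂ →ₐ[ℂ] Module.End ℂ (Fin k × Word e → ℂ) :=
  ampliation (Word.vertexEquiv k j)

theorem factorHom_apply_cons (j : Fin n) (M : Matrix (Fin k × V j) (Fin k × V j) ℂ)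
    (f : Fin k × Word e → ℂ) (a : Fin k) (v : V j) (u : Word e) (h : u.Avoids j) :
    factorHom e k j M f (a, Word.cons j v u h) =
      ∑ i, M (a, v) i * f (i.1, Word.cons j i.2 u h) :=
  ampliation_apply (Word.vertexEquiv k j) M f (a, v) ⟨u, h⟩

theorem factorHom_apply_avoids (j : Fin n) (M : Matrix (Fin k × V j) (Fin k × V j) ℂ)
    (f : Fin k × Word e → ℂ) (a : Fin k) (u : Word e) (h : u.Avoids j) :
    factorHom e k j M f (a, u) = ∑ i, M (a, e j) i * f (i.1, Word.cons j i.2 u h) := by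
  rw [← factorHom_apply_cons, Word.cons_root]

/-- Since the empty word is `e_j` followed by itself, and `v` times the empty word is empty only for
`v = e_j`, a single matrix entry survives. -/
theorem blockExp_factorHom (j : Fin n) (M : Matrix (Fin k × V j) (Fin k × V j) ℂ) (a b : Fin k) :
    blockExp k (Word.nil e) (factorHom e k j M) a b = M (a, e j) (b, e j) := by
  classical
  rw [blockExp_apply, factorHom_apply_avoids j M _ a _ (Word.avoids_nil j),
    Finset.sum_eq_single (b, e j)]
  · simp [Word.cons_root]
  · rintro ⟨b', v⟩ - hne
    rw [Pi.single_eq_of_ne, mul_zero]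
    intro H
    rw [Prod.mk.injEq] at H
    obtain ⟨rfl, H⟩ := H
    have hv : v ≠ e j := fun hv => hne (by rw [hv])
    refine Word.not_avoids_cons (Word.avoids_nil j) hv ?_
    rw [H]
    exact Word.avoids_nil j
  · simp

open scoped Kronecker in
-- The right-hand side does not depend on `j`: all factors contain the same copy of `M_k(ℂ)`, which
-- makes amalgamation over it meaningful.
theorem factorHom_kronecker_one (j : Fin n) (b : Matrix (Fin k) (Fin k) ℂ) :
    factorHom e k j (b ⊗ₖ (1 : Matrix (V j) (V j) ℂ)) = blockHom k (Word e) b := by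
  refine LinearMap.ext fun f => funext fun x => ?_
  obtain ⟨a, w⟩ := x
  obtain ⟨⟨v, u, h⟩, rfl⟩ := (Word.cons_bijective j).2 w
  simp [factorHom_apply_cons, blockHom_apply, Fintype.sum_prod_type, Matrix.one_apply]

/-- A centered element of the `j`-th factor maps functions supported on the words not beginning in
the `j`-th graph to functions supported on the words beginning there. -/
theorem factorHom_apply_eq_zero {j : Fin n} {M : Matrix (Fin k × V j) (Fin k × V j) ℂ}
    (hM : blockExp k (Word.nil e) (factorHom e k j M) = 0) {f : Fin k × Word e → ℂ}
    (hf : ∀ a u, ¬ u.Avoids j → f (a, u) = 0) {a : Fin k} {u : Word e} (hu : u.Avoids j) :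
    factorHom e k j M f (a, u) = 0 := by
  rw [factorHom_apply_avoids j M f a u hu]
  refine Finset.sum_eq_zero fun i _ => ?_
  obtain ⟨b, v⟩ := i
  -- The root terms vanish because the coefficient is an entry of the expectation, the others
  -- because `f` vanishes on words beginning in the `j`-th graph.
  by_cases hv : v = e j
  · subst hv
    rw [← blockExp_factorHom (e := e) j M a b, hM, Matrix.zero_apply, zero_mul]
  · rw [hf _ _ (Word.not_avoids_cons hu hv), mul_zero]

-- Induction on the length, peeling off the leftmost factor, which is applied last. The vanishing
-- must be known at all words avoiding `j 0`, not only at the empty word, for the next factor to be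
-- applicable.
open Classical in
theorem alternating_prod_apply_eq_zero (b : Fin k) (m : ℕ) (j : Fin (m + 1) → Fin n)
    (x : Fin (m + 1) → Module.End ℂ (Fin k × Word e → ℂ))
    (hj : ∀ p : Fin m, j p.castSucc ≠ j p.succ) (hx : ∀ p, x p ∈ (factorHom e k (j p)).range)
    (h0 : ∀ p, blockExp k (Word.nil e) (x p) = 0) (a : Fin k) (u : Word e) (hu : u.Avoids (j 0)) :
    (List.ofFn x).prod (Pi.single (b, Word.nil e) 1) (a, u) = 0 := by
  induction m generalizing a u with
  | zero =>
    obtain ⟨M, hM⟩ := hx 0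
    have hM : factorHom e k (j 0) M = x 0 := hM
    rw [List.ofFn_succ, List.ofFn_zero, List.prod_singleton, ← hM]
    refine factorHom_apply_eq_zero (by rw [hM]; exact h0 0) (fun a' u' hu' => ?_) hu
    rw [Pi.single_eq_of_ne]
    intro H
    rw [(Prod.mk.inj H).2] at hu'
    exact hu' (Word.avoids_nil _)
  | succ m ih =>
    obtain ⟨M, hM⟩ := hx 0
    have hM : factorHom e k (j 0) M = x 0 := hM
    rw [List.ofFn_succ, List.prod_cons, ← hM, Module.End.mul_apply]
    refine factorHom_apply_eq_zero (by rw [hM]; exact h0 0) (fun a' u' hu' => ?_) hu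
    exact ih (fun p => j p.succ) (fun p => x p.succ) (fun p => hj p.succ) (fun p => hx p.succ)
      (fun p => h0 p.succ) a' u' (Word.avoids_of_not_avoids (hj 0).symm hu')

/-- The factors are free with amalgamation over `M_k(ℂ)`. -/
theorem blockExp_alternating_prod (m : ℕ) (j : Fin (m + 1) → Fin n)
    (x : Fin (m + 1) → Module.End ℂ (Fin k × Word e → ℂ))
    (hj : ∀ p : Fin m, j p.castSucc ≠ j p.succ) (hx : ∀ p, x p ∈ (factorHom e k (j p)).range)
    (h0 : ∀ p, blockExp k (Word.nil e) (x p) = 0) :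
    blockExp k (Word.nil e) (List.ofFn x).prod = 0 := by
  ext a b
  exact alternating_prod_apply_eq_zero b m j x hj hx h0 a _ (Word.avoids_nil _)

end Free

/-! ### Operator-valued distributions -/

section Distribution

variable {n k : ℕ} {V : Fin n → Type u} [∀ j, Fintype (V j)] [∀ j, DecidableEq (V j)]

/-- The representation of `M_k(ℂ) ⊗ M_{V_j}(ℂ)` on functions on the free product. -/
def tensorHom (e : ∀ j, V j) (k : ℕ) (j : Fin n) :
    Matrix (Fin k) (Fin k) ℂ ⊗[ℂ] Matrix (V j) (V j) ℂ →ₐ[ℂ]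
      Module.End ℂ (Fin k × Word e → ℂ) :=
  (factorHom e k j).comp <|
    Algebra.TensorProduct.algHomOfLinearMapTensorProduct
      (TensorProduct.lift Matrix.kroneckerBilinear)
      (by intro a₁ a₂ b₁ b₂; exact Matrix.mul_kronecker_mul _ _ _ _)
      (Matrix.one_kronecker_one)

open scoped Kronecker in
theorem tensorHom_tmul (e : ∀ j, V j) (j : Fin n) (x : Matrix (Fin k) (Fin k) ℂ)
    (y : Matrix (V j) (V j) ℂ) :
    tensorHom e k j (x ⊗ₜ y) = factorHom e k j (x ⊗ₖ y) := rfl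

theorem tensorHom_mem_range (e : ∀ j, V j) (j : Fin n)
    (z : Matrix (Fin k) (Fin k) ℂ ⊗[ℂ] Matrix (V j) (V j) ℂ) :
    tensorHom e k j z ∈ (factorHom e k j).range := ⟨_, rfl⟩

theorem tensorHom_tmul_one (e : ∀ j, V j) (j : Fin n) (b : Matrix (Fin k) (Fin k) ℂ) :
    tensorHom e k j (b ⊗ₜ 1) = blockHom k (Word e) b :=
  factorHom_kronecker_one j b

theorem blockExp_tensorHom (e : ∀ j, V j) (j : Fin n)
    (z : Matrix (Fin k) (Fin k) ℂ ⊗[ℂ] Matrix (V j) (V j) ℂ) :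
    blockExp k (Word.nil e) (tensorHom e k j z) =
      tensorExp (Matrix (Fin k) (Fin k) ℂ) (vertexState (e j)) z := by
  induction z with
  | zero => simp
  | add x y hx hy => rw [map_add, map_add, map_add, hx, hy]
  | tmul x y =>
    ext a b
    rw [tensorHom_tmul, blockExp_factorHom]
    simp [tensorExp, vertexState, mul_comm]

theorem blockHom_mem_range (e : ∀ j, V j) (j : Fin n) (b : Matrix (Fin k) (Fin k) ℂ) :
    blockHom k (Word e) b ∈ (factorHom e k j).range :=
  tensorHom_tmul_one e j b ▸ tensorHom_mem_range e j _

/-- `tensorHom` is an algebra homomorphism that respects both the copies of `M_k(ℂ)` and the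
expectations, so it preserves all operator-valued moments. -/
theorem opMoment_tensorHom (e : ∀ j, V j) (j : Fin n)
    (z : Matrix (Fin k) (Fin k) ℂ ⊗[ℂ] Matrix (V j) (V j) ℂ)
    (b₀ : Matrix (Fin k) (Fin k) ℂ) (bs : List (Matrix (Fin k) (Fin k) ℂ)) :
    opMoment (blockHom k (Word e)) (blockExp k (Word.nil e)) (tensorHom e k j z) b₀ bs =
      opMoment Algebra.TensorProduct.includeLeft
        (tensorExp (Matrix (Fin k) (Fin k) ℂ) (vertexState (e j))) z b₀ bs := by
  rw [opMoment, opMoment, ← blockExp_tensorHom, map_mul (tensorHom e k j), map_list_prod,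
    List.map_map, Algebra.TensorProduct.includeLeft_apply, tensorHom_tmul_one]
  congr 4
  funext b
  rw [Function.comp_apply, map_mul, Algebra.TensorProduct.includeLeft_apply,
    tensorHom_tmul_one]

end Distribution

/-! ### Adjacency operators -/

namespace Multigraph

variable {V : Type u} (G : Multigraph.{u, v} V) (a : G.Coeff)

open Classical in
theorem adjAction_eq_sum [Fintype G.Dart] (f : V → ℂ) (x : V) :
    G.adjAction a f x = ∑ d, if G.src d = x then (a.a d : ℂ) * f (G.tgt d) else 0 := by
  rw [adjAction, finsum_eq_sum_of_fintype, ← Finset.sum_filter]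
  exact (Finset.sum_subtype _ (by simp) fun d => (a.a d : ℂ) * f (G.tgt d)).symm

open Classical in
theorem adjMatrix_eq_sum [Fintype G.Dart] (x y : V) :
    G.adjMatrix a x y = ∑ d, if G.src d = x ∧ G.tgt d = y then (a.a d : ℂ) else 0 := by
  rw [adjMatrix, Matrix.of_apply, finsum_eq_sum_of_fintype, ← Finset.sum_filter]
  exact (Finset.sum_subtype _ (by simp) fun d => (a.a d : ℂ)).symm

theorem sum_adjMatrix_mul [Fintype V] (f : V → ℂ) (x : V) :
    ∑ y, G.adjMatrix a x y * f y = G.adjAction a f x := by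
  classical
  have := G.finite_dart
  have := Fintype.ofFinite G.Dart
  simp only [adjMatrix_eq_sum, adjAction_eq_sum, Finset.sum_mul]
  rw [Finset.sum_comm]
  refine Finset.sum_congr rfl fun d _ => ?_
  by_cases h : G.src d = x <;> simp [h, ite_mul]

-- Writing every color class as a sum over all darts of `G` allows the sum over colors to be
-- collapsed later.
open Classical in
theorem adjAction_ofColor [Fintype G.Dart] {C : Type w} (c : G.Coloring C) (α : C) (f : V → ℂ)
    (x : V) :
    (G.ofColor c α).adjAction (a.ofColor c α) f x =
      ∑ d, if c.col d = α then if G.src d = x then (a.a d : ℂ) * f (G.tgt d) else 0 else 0 := by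
  have : Fintype (G.ofColor c α).Dart := inferInstanceAs (Fintype {d : G.Dart // c.col d = α})
  rw [adjAction_eq_sum, ← Finset.sum_filter (fun d => c.col d = α)]
  exact (Finset.sum_subtype _ (by simp)
    fun d => if G.src d = x then (a.a d : ℂ) * f (G.tgt d) else 0).symm

/-- The adjacency operator of a component is the restriction of that of the graph. -/
theorem adjAction_component (r : V) (f : V → ℂ) (x : {x : V // G.Reachable r x}) :
    (G.component r).adjAction (a.component r) (fun y => f y.1) x = G.adjAction a f x.1 := by
  refine finsum_eq_of_bijective
    (fun d : {d : (G.component r).Dart // (G.component r).src d = x} =>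
      (⟨d.1.1, congrArg Subtype.val d.2⟩ : {d : G.Dart // G.src d = x.1})) ⟨?_, ?_⟩ fun d => rfl
  · exact fun d d' h => Subtype.ext (Subtype.ext (Subtype.mk.inj h))
  · rintro ⟨d, hd⟩
    exact ⟨⟨⟨d, hd ▸ x.2⟩, Subtype.ext hd⟩, rfl⟩

theorem adjAction_add (f g : V → ℂ) (x : V) :
    G.adjAction a (f + g) x = G.adjAction a f x + G.adjAction a g x := by
  have := G.locallyFinite x
  simp only [adjAction, Pi.add_apply, mul_add]
  exact finsum_add_distrib (Set.toFinite _) (Set.toFinite _)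

theorem adjAction_smul (z : ℂ) (f : V → ℂ) (x : V) :
    G.adjAction a (z • f) x = z * G.adjAction a f x := by
  simp only [adjAction, Pi.smul_apply, smul_eq_mul, mul_left_comm _ z]
  exact (mul_finsum _ _).symm

variable {G a}

/-- If finitely many labels distinguish the edges leaving each vertex, then the number of edges
leaving a vertex is bounded by the number of labels. -/
theorem sum_norm_adjAction_sq_le {P : Type*} [Fintype P] (label : G.Dart → P)
    (hl : ∀ d d', label d = label d' → G.src d = G.src d' → d = d')
    {K : ℝ} (hK : ∀ d, |a.a d| ≤ K) (f : lp (fun _ : V => ℂ) 2) (s : Finset V) :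
    ∑ x ∈ s, ‖G.adjAction a f x‖ ^ 2 ≤ (Fintype.card P * K * ‖f‖) ^ 2 := by
  classical
  have := G.locallyFinite
  have := fun x => Fintype.ofFinite {d : G.Dart // G.src d = x}
  have hcard : ∀ x, Fintype.card {d : G.Dart // G.src d = x} ≤ Fintype.card P := fun x =>
    Fintype.card_le_of_injective (fun d => label d.1) fun d d' h =>
      Subtype.ext (hl _ _ h (d.2.trans d'.2.symm))
  -- Cauchy–Schwarz over the edges leaving `x`, of which there are at most `card P`.
  have hpoint : ∀ x, ‖G.adjAction a f x‖ ^ 2 ≤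
      Fintype.card P * K ^ 2 * ∑ d : {d : G.Dart // G.src d = x}, ‖f (G.tgt d.1)‖ ^ 2 := by
    intro x
    rw [adjAction, finsum_eq_sum_of_fintype]
    calc _ ≤ (∑ d : {d : G.Dart // G.src d = x}, ‖(a.a d.1 : ℂ) * f (G.tgt d.1)‖) ^ 2 := by
          gcongr; exact norm_sum_le _ _
      _ ≤ Fintype.card {d : G.Dart // G.src d = x} *
            ∑ d : {d : G.Dart // G.src d = x}, ‖(a.a d.1 : ℂ) * f (G.tgt d.1)‖ ^ 2 :=
          sq_sum_le_card_mul_sum_sq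
      _ ≤ Fintype.card P *
            ∑ d : {d : G.Dart // G.src d = x}, K ^ 2 * ‖f (G.tgt d.1)‖ ^ 2 := by
          gcongr with d _
          · exact hcard x
          · rw [norm_mul, mul_pow, Complex.norm_real, Real.norm_eq_abs]
            gcongr
            exact hK _
      _ = _ := by rw [← Finset.mul_sum, mul_assoc]
  -- Edges are grouped by the label of their reversal. Within a group the target determines the
  -- edge, as it is the source of the reversal; so each `‖f y‖ ^ 2` is counted at most once. Summing
  -- over the labels supplies the second factor `card P`.
  have hlabel : ∀ p : P, ∑ d ∈ (s.sigma fun x =>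
      (Finset.univ : Finset {d : G.Dart // G.src d = x})) with label (G.rev d.2.1) = p,
        ‖f (G.tgt d.2.1)‖ ^ 2 ≤ ‖f‖ ^ 2 := by
    intro p
    have hinj : Set.InjOn (fun d : Σ x, {d : G.Dart // G.src d = x} => G.tgt d.2.1)
        ↑((s.sigma fun x => (Finset.univ : Finset {d : G.Dart // G.src d = x})).filter
          fun d => label (G.rev d.2.1) = p) := by
      rintro ⟨x, d, rfl⟩ hd ⟨x', d', rfl⟩ hd' h
      simp only [Finset.coe_filter, Set.mem_ofPred_eq] at hd hd' h
      have : d = d' := by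
        rw [← G.rev_rev d, ← G.rev_rev d', hl _ _ (hd.2.trans hd'.2.symm)]
        rw [G.src_rev, G.src_rev, h]
      subst this
      rfl
    rw [← Finset.sum_image (f := fun y => ‖f y‖ ^ 2) hinj]
    simpa using lp.sum_rpow_le_norm_rpow (p := 2) (by norm_num) f _
  calc ∑ x ∈ s, ‖G.adjAction a f x‖ ^ 2
      ≤ ∑ x ∈ s, Fintype.card P * K ^ 2 *
          ∑ d : {d : G.Dart // G.src d = x}, ‖f (G.tgt d.1)‖ ^ 2 :=
        Finset.sum_le_sum fun x _ => hpoint x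
    _ = Fintype.card P * K ^ 2 * ∑ p : P, ∑ d ∈ (s.sigma fun x =>
          (Finset.univ : Finset {d : G.Dart // G.src d = x})) with label (G.rev d.2.1) = p,
            ‖f (G.tgt d.2.1)‖ ^ 2 := by
        rw [← Finset.mul_sum]
        congr 1
        exact (Finset.sum_sigma s (fun x => (Finset.univ : Finset {d : G.Dart // G.src d = x}))
          fun d => ‖f (G.tgt d.2.1)‖ ^ 2).symm.trans (Finset.sum_fiberwise _ _ _).symm
    _ ≤ Fintype.card P * K ^ 2 * ∑ _p : P, ‖f‖ ^ 2 := by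
        gcongr with p _
        exact hlabel p
    _ = _ := by
        rw [Finset.sum_const, Finset.card_univ, nsmul_eq_mul]
        ring

/-- The Jacobi operator of a graph with bounded coefficients and finitely many edge labels
distinguishing the edges at each vertex is bounded. -/
theorem exists_isJacobiOperator {P : Type*} [Finite P] (label : G.Dart → P)
    (hl : ∀ d d', label d = label d' → G.src d = G.src d' → d = d')
    {K : ℝ} (hK0 : 0 ≤ K) (hK : ∀ d, |a.a d| ≤ K) :
    ∃ J : lp (fun _ : V => ℂ) 2 →L[ℂ] lp (fun _ : V => ℂ) 2, G.IsJacobiOperator a J := by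
  have := Fintype.ofFinite P
  have hle := sum_norm_adjAction_sq_le (a := a) label hl hK
  have hmem : ∀ f : lp (fun _ : V => ℂ) 2, Memℓp (G.adjAction a f) 2 := fun f =>
    memℓp_gen' (C := (Fintype.card P * K * ‖f‖) ^ 2) fun s => by simpa using hle f s
  refine ⟨LinearMap.mkContinuous
    { toFun f := (⟨G.adjAction a f, hmem f⟩ : lp (fun _ : V => ℂ) 2)
      map_add' f g := lp.ext (funext fun x => G.adjAction_add a f g x)
      map_smul' z f := lp.ext (funext fun x => G.adjAction_smul a z f x) }
    (Fintype.card P * K) fun f => ?_, fun f x => rfl⟩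
  refine lp.norm_le_of_forall_sum_le (by norm_num) (by positivity) fun s => ?_
  simpa using hle f s

theorem delta_apply [DecidableEq V] (x y : V) :
    (delta x : V → ℂ) y = if y = x then 1 else 0 := by
  by_cases h : y = x
  · subst h
    rw [if_pos rfl]
    exact @Pi.single_eq_same _ _ _ (Classical.decEq V) _ _
  · rw [if_neg h]
    exact @Pi.single_eq_of_ne _ _ _ (Classical.decEq V) _ _ h _

theorem rootState_eq (x : V) (X : lp (fun _ : V => ℂ) 2 →L[ℂ] lp (fun _ : V => ℂ) 2) :
    rootState x X = X (delta x) x := by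
  classical
  rw [rootState, delta, lp.inner_single_left]
  simp

end Multigraph

/-! ### The sum of the factors -/

section Sum

variable {n k : ℕ} {V : Fin n → Type u} [∀ j, Fintype (V j)] [∀ j, DecidableEq (V j)]
  {C : Fin n → Type w} [∀ j, Fintype (C j)]
  {G : ∀ j, Multigraph.{u, v} (V j)} (e : ∀ j, V j)
  (c : ∀ j, (G j).Coloring (C j)) (a : ∀ j, (G j).Coeff)
  {R : Multigraph.{0, v'} (Fin k)} (c₀ : R.Coloring (Σ j, C j)) (a₀ : R.Coeff)

/-- The element `∑ X_α ⊗ A_α` of `M_k(ℂ) ⊗ M_{V_j}(ℂ)`. -/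
def colorSum (j : Fin n) : Matrix (Fin k) (Fin k) ℂ ⊗[ℂ] Matrix (V j) (V j) ℂ :=
  ∑ α : C j, (R.ofColor c₀ ⟨j, α⟩).adjMatrix (a₀.ofColor c₀ ⟨j, α⟩) ⊗ₜ[ℂ]
    ((G j).ofColor (c j) α).adjMatrix ((a j).ofColor (c j) α)

-- Summing over colors leaves exactly the pairs `(d, d₀)` of equal color: this is the color-matching
-- condition in the edges of the product.
open Classical in
theorem tensorHom_colorSum_apply [Fintype R.Dart] [∀ j, Fintype (G j).Dart] (j : Fin n)
    (f : Fin k × Word e → ℂ) (b : Fin k) (v : V j) (u : Word e) (h : u.Avoids j) :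
    tensorHom e k j (colorSum c a c₀ a₀ j) f (b, Word.cons j v u h) =
      ∑ d : (G j).Dart, ∑ d₀ : R.Dart,
        if c₀.col d₀ = ⟨j, (c j).col d⟩ ∧ R.src d₀ = b ∧ (G j).src d = v then
          ((a₀.a d₀ * (a j).a d : ℝ) : ℂ) * f (R.tgt d₀, Word.cons j ((G j).tgt d) u h)
        else 0 := by
  have key : ∀ α : C j, tensorHom e k j
      ((R.ofColor c₀ ⟨j, α⟩).adjMatrix (a₀.ofColor c₀ ⟨j, α⟩) ⊗ₜ[ℂ] ((G j).ofColor (c j) α).adjMatrix ((a j).ofColor (c j) α)) f (b, Word.cons j v u h) =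
      ∑ d : (G j).Dart, if (c j).col d = α then ∑ d₀ : R.Dart,
        if c₀.col d₀ = ⟨j, (c j).col d⟩ ∧ R.src d₀ = b ∧ (G j).src d = v then
          ((a₀.a d₀ * (a j).a d : ℝ) : ℂ) * f (R.tgt d₀, Word.cons j ((G j).tgt d) u h)
        else 0 else 0 := by
    intro α
    rw [tensorHom_tmul, factorHom_apply_cons, Fintype.sum_prod_type]
    -- A Kronecker product of adjacency matrices acts as two nested adjacency actions, that of `G j`
    -- inside that of `R`.
    simp only [Matrix.kroneckerMap_apply, mul_assoc, ← Finset.mul_sum]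
    simp only [Multigraph.sum_adjMatrix_mul _ _
      (fun v' => f (_, Word.cons j v' u h))]
    rw [Multigraph.sum_adjMatrix_mul _ _ (fun b' => Multigraph.adjAction _ _
      (fun v' => f (b', Word.cons j v' u h)) v), Multigraph.adjAction_ofColor]
    trans ∑ d₀ : R.Dart, ∑ d : (G j).Dart, if (c j).col d = α then
        if c₀.col d₀ = ⟨j, (c j).col d⟩ ∧ R.src d₀ = b ∧ (G j).src d = v then
          ((a₀.a d₀ * (a j).a d : ℝ) : ℂ) * f (R.tgt d₀, Word.cons j ((G j).tgt d) u h)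
        else 0 else 0
    · refine Finset.sum_congr rfl fun d₀ _ => ?_
      rw [Multigraph.adjAction_ofColor, Finset.mul_sum, Finset.ite_sum_zero,
        Finset.ite_sum_zero]
      refine Finset.sum_congr rfl fun d _ => ?_
      by_cases hd : (c j).col d = α
      · subst hd
        by_cases h₁ : c₀.col d₀ = ⟨j, (c j).col d⟩ <;> by_cases h₂ : R.src d₀ = b <;>
          by_cases h₃ : (G j).src d = v <;> simp [h₁, h₂, h₃, mul_assoc]
      · simp [hd]
    · rw [Finset.sum_comm]
      refine Finset.sum_congr rfl fun d _ => ?_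
      split_ifs with hd
      · rfl
      · exact Finset.sum_const_zero
  -- Each `d` has exactly one color, so after exchanging the sums only one `α` contributes.
  rw [colorSum, map_sum, LinearMap.sum_apply, Finset.sum_apply,
    Finset.sum_congr rfl fun α _ => key α, Finset.sum_comm]
  simp

/-- The sum of the factors is the adjacency operator of the product. -/
theorem sum_tensorHom_colorSum_apply (f : Fin k × Word e → ℂ) (x : Fin k × Word e) :
    (∑ j, tensorHom e k j (colorSum c a c₀ a₀ j)) f x =
      (amalgProd e G c R c₀).adjAction (liftCoeff e c c₀ a a₀) f x := by
  classical
  have := R.finite_dart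
  have := fun j => (G j).finite_dart
  have := Fintype.ofFinite R.Dart
  have := fun j => Fintype.ofFinite (G j).Dart
  obtain ⟨b, w⟩ := x
  have := (amalgProd e G c R c₀).locallyFinite (b, w)
  have := Fintype.ofFinite
    {d : (amalgProd e G c R c₀).Dart // (amalgProd e G c R c₀).src d = (b, w)}
  -- For each `j`, `p j` is the decomposition `w = v u` relative to the `j`-th graph.
  choose p hp using fun j => (Word.cons_bijective j).2 w
  have hterm : ∀ j, tensorHom e k j (colorSum c a c₀ a₀ j) f (b, w) =
      ∑ d : (G j).Dart, ∑ d₀ : R.Dart,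
        if c₀.col d₀ = ⟨j, (c j).col d⟩ ∧ R.src d₀ = b ∧ (G j).src d = (p j).1 then
          ((a₀.a d₀ * (a j).a d : ℝ) : ℂ) *
            f (R.tgt d₀, Word.cons j ((G j).tgt d) (p j).2.1 (p j).2.2)
        else 0 := fun j => by
    rw [← tensorHom_colorSum_apply]
    exact congrArg _ (Prod.ext rfl (hp j).symm)
  rw [LinearMap.sum_apply, Finset.sum_apply, Finset.sum_congr rfl fun j _ => hterm j,
    ← Fintype.sum_sigma' (fun j (d : (G j).Dart) => ∑ d₀ : R.Dart, _),
    ← Fintype.sum_prod_type', ← Finset.sum_filter, Multigraph.adjAction, finsum_eq_sum_of_fintype]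
  -- By uniqueness of the decomposition, an edge leaving `(b, w)` has its `u` prescribed by `w` and
  -- `j`; only the pair `(d, d₀)` remains free.
  have hsplit : ∀ D : {D : (amalgProd e G c R c₀).Dart // (amalgProd e G c R c₀).src D = (b, w)},
      p D.1.j = ((G D.1.j).src D.1.d, ⟨D.1.u, D.1.avoids⟩) := fun D =>
    (Word.cons_bijective D.1.j).1 ((hp D.1.j).trans (Prod.mk.inj D.2).2.symm)
  symm
  refine Finset.sum_bij (fun D _ => (⟨D.1.j, D.1.d⟩, D.1.d₀)) ?_ ?_ ?_ ?_
  · intro D _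
    rw [Finset.mem_filter]
    exact ⟨Finset.mem_univ _, D.1.color_eq, (Prod.mk.inj D.2).1,
      (congrArg Prod.fst (hsplit D)).symm⟩
  · rintro ⟨⟨j, d, d₀, u, h, hc⟩, hx⟩ - ⟨⟨j', d', d₀', u', h', hc'⟩, hx'⟩ - H
    simp only [Prod.mk.injEq, Sigma.mk.injEq] at H
    obtain ⟨⟨rfl, H⟩, rfl⟩ := H
    obtain rfl := eq_of_heq H
    obtain rfl : u = u' :=
      Word.cons_injective j _ (h := h) (h' := h') (congrArg Prod.snd (hx.trans hx'.symm))
    rfl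
  · rintro ⟨⟨j, d⟩, d₀⟩ hd
    obtain ⟨-, h₁, h₂, h₃⟩ := Finset.mem_filter.1 hd
    refine ⟨⟨⟨j, d, d₀, (p j).2.1, (p j).2.2, h₁⟩, Prod.ext h₂ ?_⟩, Finset.mem_univ _, rfl⟩
    refine Eq.trans ?_ (hp j)
    exact congrArg (fun v => Word.cons j v (p j).2.1 (p j).2.2) h₃
  · intro D _
    have hu : (p D.1.j).2 = ⟨D.1.u, D.1.avoids⟩ := congrArg Prod.snd (hsplit D)
    simp only [hu]
    rfl

/-- The moments of the sum of the factors at the root are those of the Jacobi operator of the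
core. -/
theorem sum_tensorHom_pow_apply_eq (r : Fin k)
    {J : lp (fun _ => ℂ) 2 →L[ℂ] lp (fun _ => ℂ) 2}
    (hJ : (core e G c R c₀ r).IsJacobiOperator (coreCoeff e c c₀ r a a₀) J)
    {g : Fin k × Word e → ℂ} {f : lp (fun _ => ℂ) 2} (hfg : ∀ x, f x = g x.1) (p : ℕ)
    (x : {x // (amalgProd e G c R c₀).Reachable (r, Word.nil e) x}) :
    (J ^ p) f x = ((∑ j, tensorHom e k j (colorSum c a c₀ a₀ j)) ^ p) g x.1 := by
  -- The functions need to agree only on the core: the adjacency action at a core vertex involves no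
  -- vertex outside it.
  induction p generalizing x with
  | zero => exact hfg x
  | succ p ih =>
    rw [pow_succ', pow_succ', mul_apply_eq_comp, Module.End.mul_apply, hJ,
      sum_tensorHom_colorSum_apply, ← Multigraph.adjAction_component _ _ (r, Word.nil e)]
    exact congrArg (fun h => (core e G c R c₀ r).adjAction (coreCoeff e c c₀ r a a₀) h x)
      (funext ih)

-- The pair `(d, d₀)` labels the edges: with the source given, it determines `u` because `Word.cons`
-- is injective in the word.
omit [∀ j, DecidableEq (V j)] [∀ j, Fintype (C j)] in
theorem exists_isJacobiOperator_core (r : Fin k) :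
    ∃ J : lp (fun _ => ℂ) 2 →L[ℂ] lp (fun _ => ℂ) 2,
      (core e G c R c₀ r).IsJacobiOperator (coreCoeff e c c₀ r a a₀) J := by
  have := R.finite_dart
  have := fun j => (G j).finite_dart
  have hfin := Set.finite_range fun q : (Σ j, (G j).Dart) × R.Dart => |a₀.a q.2 * (a q.1.1).a q.1.2|
  obtain ⟨K, hK⟩ := hfin.bddAbove
  -- The maximum with `0` is needed because the upper bound `K` of an empty set of coefficients may
  -- be negative.
  refine Multigraph.exists_isJacobiOperator (P := (Σ j, (G j).Dart) × R.Dart)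
    (fun D => (⟨D.1.j, D.1.d⟩, D.1.d₀)) ?_ (le_max_right K 0)
    (fun D => (hK ⟨(⟨D.1.j, D.1.d⟩, D.1.d₀), rfl⟩).trans (le_max_left K 0))
  rintro ⟨⟨j, d, d₀, u, h, hc⟩, hx⟩ ⟨⟨j', d', d₀', u', h', hc'⟩, hx'⟩ H H'
  simp only [Prod.mk.injEq, Sigma.mk.injEq] at H
  obtain ⟨⟨rfl, H⟩, rfl⟩ := H
  obtain rfl := eq_of_heq H
  obtain rfl : u = u' := Word.cons_injective j _ (h := h) (h' := h')
    (congrArg (fun x : {x // (amalgProd e G c R c₀).Reachable (r, Word.nil e) x} => x.1.2) H')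
  rfl

end Sum

end FreeGraphProduct

end

/-! ### Assembling the probability space -/

theorem theorem4 (n k : ℕ)
    -- the finite rooted graphs `𝒢_j` with their edge colorings and coefficients
    (V : Fin n → Type u) [∀ j, Fintype (V j)] [∀ j, DecidableEq (V j)]
    (C : Fin n → Type w) [∀ j, Fintype (C j)]
    (G : ∀ j, Multigraph.{u, v} (V j)) (e : ∀ j, V j)
    (c : ∀ j, (G j).Coloring (C j)) (a : ∀ j, (G j).Coeff)
    -- the relator graph with vertex set `[k]`, its root, coloring and coefficients
    (R : Multigraph.{0, v'} (Fin k)) (r : Fin k)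
    (c₀ : R.Coloring (Σ j, C j)) (a₀ : R.Coeff) :
    ∃ (A : Type u) (_ : Ring A) (_ : Algebra ℂ A) (τ : A →ₗ[ℂ] ℂ) (T : Fin n → A),
      τ 1 = 1 ∧
      -- the sum is distributed as the Jacobi operator of the core
      (∃ J : lp (fun _ => ℂ) 2 →L[ℂ] lp (fun _ => ℂ) 2,
        (core e G c R c₀ r).IsJacobiOperator (coreCoeff e c c₀ r a a₀) J ∧
        ∀ p : ℕ, τ ((∑ j, T j) ^ p) =
          Multigraph.rootState (coreRoot e G c R c₀ r) (J ^ p)) ∧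
      ∃ (B : Subalgebra ℂ A) (θ : Matrix (Fin k) (Fin k) ℂ ≃ₐ[ℂ] B) (E : A →ₗ[ℂ] B),
        -- freeness with amalgamation over `B ≅ M_k(ℂ)`
        IsCondExp B E ∧ (∀ x : A, τ (E x) = τ x) ∧
        FreeWithAmalgamation B E (fun j => adjoinVar B (T j)) ∧
        -- each `T_j` has the same `M_k(ℂ)`-valued distribution as `∑ X_α ⊗ A_α`
        ∀ j : Fin n,
          SameOpDistribution
            (B.val.comp θ.toAlgHom) (θ.symm.toLinearMap ∘ₗ E) (T j)
            (Algebra.TensorProduct.includeLeft :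
              Matrix (Fin k) (Fin k) ℂ →ₐ[ℂ]
                Matrix (Fin k) (Fin k) ℂ ⊗[ℂ] Matrix (V j) (V j) ℂ)
            (tensorExp (Matrix (Fin k) (Fin k) ℂ) (vertexState (e j)))
            (∑ α : C j,
              (R.ofColor c₀ ⟨j, α⟩).adjMatrix (a₀.ofColor c₀ ⟨j, α⟩) ⊗ₜ[ℂ]
                ((G j).ofColor (c j) α).adjMatrix ((a j).ofColor (c j) α)) := by
  classical
  obtain ⟨J, hJ⟩ := exists_isJacobiOperator_core e c a c₀ a₀ r
  let w : Word e := Word.nil e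
  let θ := AlgEquiv.ofInjective (blockHom k (Word e)) (blockHom_injective w)
  have hE : ∀ b : Matrix (Fin k) (Fin k) ℂ, ((θ b : (blockHom k (Word e)).range) :
      Module.End ℂ (Fin k × Word e → ℂ)) = blockHom k (Word e) b := fun b => rfl
  refine ⟨Module.End ℂ (Fin k × Word e → ℂ), inferInstance, inferInstance,
    Matrix.entryLinearMap ℂ ℂ r r ∘ₗ blockExp k w, fun j => tensorHom e k j (colorSum c a c₀ a₀ j),
    ?_, ⟨J, hJ, fun p => ?_⟩, (blockHom k (Word e)).range, θ,
    θ.toLinearMap ∘ₗ blockExp k w, ⟨fun b => ?_, fun b₁ b₂ x => ?_⟩, fun x => ?_,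
    ⟨fun j => ?_, fun m j x hj hx h0 => ?_⟩, fun j b₀ bs => ?_⟩
  · simp [blockExp_one]
  · rw [Multigraph.rootState_eq]
    -- The root vector of the core is the restriction of the point mass at `(r, w)` on the whole
    -- product.
    refine Eq.trans ?_ (sum_tensorHom_pow_apply_eq e c a c₀ a₀ r hJ
      (g := Pi.single (r, w) 1) (fun x => ?_) p _).symm
    · rfl
    · rw [Multigraph.delta_apply, Pi.single_apply]
      exact if_congr Subtype.ext_iff rfl rfl
  · obtain ⟨b, rfl⟩ := θ.surjective b
    simp [hE, blockExp_blockHom]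
  · obtain ⟨b₁, rfl⟩ := θ.surjective b₁
    obtain ⟨b₂, rfl⟩ := θ.surjective b₂
    simp [hE, blockExp_mul_blockHom, blockExp_blockHom_mul]
  · simp [hE, blockExp_blockHom]
  · exact fun b hb => Algebra.subset_adjoin (Or.inl hb)
  · have hle : ∀ j, adjoinVar (blockHom k (Word e)).range
        (tensorHom e k j (colorSum c a c₀ a₀ j)) ≤ (factorHom e k j).range := by
      intro j
      refine Algebra.adjoin_le (Set.union_subset ?_ ?_)
      · rintro _ ⟨b, rfl⟩
        exact blockHom_mem_range e j b
      · exact Set.singleton_subset_iff.2 (tensorHom_mem_range e j _)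
    rw [LinearMap.comp_apply, blockExp_alternating_prod m j x hj (fun p => hle _ (hx p)), map_zero]
    exact fun p => θ.injective ((h0 p).trans (map_zero θ).symm)
  · rw [← opMoment_tensorHom]
    exact θ.symm_apply_apply _
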